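/- Let $\mathbb S^3=\{p\in\mathbb C^2:\|p\|=1\}$, let $\pi:\mathbb S^3\to\mathbb{CP}^1$, $\pi(z_1,z_2)=[z_1:z_2]$, be the Hopf fibration, and equip $\mathbb{CP}^1$ with the Fubini–Study volume normalized to total mass $\pi$, that is, $(1+|w|^2)^{-2}\,dA(w)$ in the affine chart $w\mapsto[1:w]$. For an integer $r\ge 1$ the Spherical ensemble of $r$ points is the (simple) determinantal point process of $r$ points on $\mathbb{CP}^1$ whose kernel with respect to this volume is $K_r(x,y)=\frac r\pi\langle p,q\rangle^{r-1}$, where $p,q\in\mathbb S^3$ are chosen unit representatives of $x=[p]$, $y=[q]$ (the correlation functions do not depend on the choice). Let $r,k\ge1$ be integers and $N=kr$. Let $x_1,\dots,x_r\in\mathbb{CP}^1$ be random points sampled from the Spherical ensemble of $r$ points, let $s:\mathbb{CP}^1\to\mathbb S^3$ be a measurable choice of unit representatives ($\pi(s(x))=x$ for all $x$), and let $\theta_1,\dots,\theta_r$ be independent phases, uniform on $[0,2\pi]$ and independent of $(x_1,\dots,x_r)$. Let $\omega_N\subset\mathbb S^3$ consist of the $N$ points $$y_{ij}=e^{\mathrm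 i(\theta_i+2\pi j/k)}\,s(x_i),\qquad 1\le i\le r,\quad 0\le j\le k-1,$$ and let $E_0(\omega_N)=\sum_{(i,j)\ne(i',j')}\log\frac1{\|y_{ij}-y_{i'j'}\|}$ be its logarithmic energy (sum over ordered pairs). Then $E_0(\omega_N)$ is integrable, $$\mathbb E[E_0(\omega_N)]=-\frac{k^2r^2}{4}-rk\log k+k^2\,\frac{\sqrt\pi\,\Gamma(r+1)}{4\,\Gamma(r+\frac12)}-\frac{k^2}{4},$$ and there is an absolute constant $C$ such that, for all $r,k\ge1$ with $N=kr$, $$\left|\,\mathbb E[E_0(\omega_N)]-\left(-\frac{N^2}{4}-N\log k+\frac{\sqrt\pi}{4}\sqrt N\,k^{3/2}-\frac{k^2}{4}\right)\right|\le C\,k^2\sqrt{\frac kN}.$$ -/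

import Mathlib

open MeasureTheory ProbabilityTheory
open scoped NNReal ENNReal

noncomputable section

namespace HopfSpherical

/-! ### The Hopf fibration -/

/-- The Hermitian plane `ℂ²` with its Euclidean norm. -/
abbrev C2 : Type := EuclideanSpace ℂ (Fin 2)

/-- The unit sphere `𝕊³` of `ℂ²`; its metric is the Euclidean (chordal) distance. -/
abbrev S3 : Type := Metric.sphere (0 : C2) 1

/-- The complex projective line. -/
abbrev CP1 : Type := Projectivization ℂ C2

/-- The quotient sigma-algebra of the projective line: a set is measurable when the set of its
homogeneous coordinates is a Borel set of `ℂ² ∖ {0}`. -/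
instance instMeasurableSpaceCP1 : MeasurableSpace CP1 :=
  MeasurableSpace.map (Projectivization.mk' ℂ)
    (inferInstance : MeasurableSpace {v : C2 // v ≠ 0})

lemma S3_ne_zero (p : S3) : (p : C2) ≠ 0 := ne_zero_of_mem_unit_sphere p

/-- The Hopf fibration `(z₁, z₂) ↦ [z₁ : z₂]`. -/
def hopf (p : S3) : CP1 := Projectivization.mk ℂ (p : C2) (S3_ne_zero p)

/-- The circle action `p ↦ e^{it} p` on `𝕊³`, whose orbits are the Hopf fibres. -/
def phase (t : ℝ) (p : S3) : S3 :=
  ⟨Complex.exp (t * Complex.I) • (p : C2), by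
    rw [mem_sphere_zero_iff_norm, norm_smul, Complex.norm_exp_ofReal_mul_I, one_mul]
    exact mem_sphere_zero_iff_norm.mp p.2⟩

/-- The `j`-th of `k` points placed at the `k`-th roots of unity, rotated by the phase `t`, on the
fibre through `p`. -/
def fibrePoint (k : ℕ) (t : ℝ) (p : S3) (j : Fin k) : S3 :=
  phase (t + 2 * Real.pi * (j : ℕ) / k) p

/-- Lift to `𝕊³` of `r` base points `x` of the projective line: `k` rotated roots of unity on the
fibre over each `x i`. Here `s` chooses a unit representative of each point of the projective line
and `θ i` is the phase used on the fibre over `x i`. -/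
def hopfLift {r : ℕ} (k : ℕ) (s : CP1 → S3) (x : Fin r → CP1) (θ : Fin r → ℝ) :
    Fin r × Fin k → S3 :=
  fun ij => fibrePoint k (θ ij.1) (s (x ij.1)) ij.2

/-- The discrete logarithmic energy: the sum of `log (1 / ‖y i - y j‖)` over ordered pairs
`i ≠ j`. -/
def logEnergy {ι E : Type*} [Fintype ι] [DecidableEq ι] [MetricSpace E] (y : ι → E) : ℝ :=
  ∑ i, ∑ j ∈ Finset.univ.filter (fun j => j ≠ i), Real.log (1 / dist (y i) (y j))

/-! ### Fubini-Study volume -/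

lemma affine_ne_zero (w : ℂ) : (WithLp.toLp 2 ![1, w] : C2) ≠ 0 := by
  intro h
  have := congrArg (fun v : C2 => v 0) h
  simp at this

/-- The affine chart `w ↦ [1 : w]`. -/
def affineChart (w : ℂ) : CP1 := Projectivization.mk ℂ (WithLp.toLp 2 ![1, w]) (affine_ne_zero w)

/-- The Fubini-Study volume, of total mass `π`: in the affine chart `w ↦ [1 : w]` it is
`(1 + |w|²)⁻² dA(w)`, and the point `[0 : 1]` at infinity has measure zero. -/
def fubiniStudy : Measure CP1 :=
  Measure.map affineChart
    ((volume : Measure ℂ).withDensity fun w => ENNReal.ofReal (1 / (1 + ‖w‖ ^ 2) ^ 2))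

lemma measurable_affineChart : Measurable affineChart := by
  have h1 : Measurable (fun w : ℂ =>
      (⟨WithLp.toLp 2 ![1, w], affine_ne_zero w⟩ : {v : C2 // v ≠ 0})) := by
    refine Measurable.subtype_mk ?_
    refine (WithLp.measurable_toLp 2 _).comp ?_
    refine measurable_pi_iff.mpr fun i => ?_
    fin_cases i
    · exact measurable_const
    · exact measurable_id
  have h2 : Measurable (Projectivization.mk' ℂ : {v : C2 // v ≠ 0} → CP1) := fun _ h => h
  exact h2.comp h1

/-! ### Determinantal point processes -/

section RandomPoints

variable {Ω Λ : Type*} [MeasurableSpace Ω] [MeasurableSpace Λ]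

/-- The number of points of the configuration `x` that lie in `D`. -/
def countIn {n : ℕ} (x : Fin n → Λ) (D : Set Λ) : ℕ := Set.ncard {i | x i ∈ D}

/-- `ρ` is the `k`-point intensity function, with respect to `μ`, of the process of `n` random
points `X`: for pairwise disjoint `D₁, …, D_k`, the expectation of `∏ #(X ∩ D_i)` is the integral
of `ρ` over `∏ D_i`, and `ρ` vanishes when two of its arguments agree. -/
structure IsIntensity (μ : Measure Λ) (P : Measure Ω) {n k : ℕ} (X : Fin n → Ω → Λ)
    (ρ : (Fin k → Λ) → ℝ≥0) : Prop where
  measurable : Measurable ρ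
  eq_zero : ∀ y : Fin k → Λ, ¬ Function.Injective y → ρ y = 0
  lintegral_prod : ∀ D : Fin k → Set Λ, (∀ i, MeasurableSet (D i)) →
    Pairwise (Function.onFun Disjoint D) →
    ∫⁻ ω, ∏ i, (countIn (fun a => X a ω) (D i) : ℝ≥0∞) ∂P
      = ∫⁻ y in Set.univ.pi D, (ρ y : ℝ≥0∞) ∂(Measure.pi fun _ => μ)

/-- The random points `X` form a simple determinantal point process of `n` points with kernel `K`
with respect to `μ`: for `1 ≤ k ≤ n` the `k`-point intensity function is `det (K (x_i, x_j))`. -/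
structure IsDeterminantal (μ : Measure Λ) (P : Measure Ω) {n : ℕ} (K : Λ → Λ → ℂ)
    (X : Fin n → Ω → Λ) : Prop where
  measurable_kernel : Measurable (Function.uncurry K)
  measurable_points : ∀ i, Measurable (X i)
  simple : ∀ᵐ ω ∂P, Function.Injective fun i => X i ω
  intensity : ∀ k : ℕ, 1 ≤ k → k ≤ n → ∃ ρ : (Fin k → Λ) → ℝ≥0,
    IsIntensity μ P X ρ ∧
    ∀ x : Fin k → Λ, (((ρ x : ℝ≥0) : ℝ) : ℂ) = (Matrix.of fun i j => K (x i) (x j)).det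

end RandomPoints

/-! ### The Spherical ensemble -/

/-- The unit vector proportional to `v` whose first coordinate is positive, or `(0, 1)` if the
first coordinate of `v` vanishes. -/
def normalizeVec (v : C2) : C2 :=
  if v 0 = 0 then WithLp.toLp 2 ![0, 1]
  else (starRingEnd ℂ (v 0) / (‖v 0‖ * ‖v‖ : ℝ)) • v

lemma normalizeVec_smul (t : ℂ) (ht : t ≠ 0) (v : C2) :
    normalizeVec (t • v) = normalizeVec v := by
  unfold normalizeVec
  by_cases h : v 0 = 0
  · simp [h]
  · have h' : (t • v) 0 ≠ 0 := by simp [h, ht]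
    rw [if_neg h, if_neg h', smul_smul]
    congr 1
    have hv : v ≠ 0 := by rintro rfl; simp at h
    have hn : (‖v‖ : ℂ) ≠ 0 := by simpa using hv
    have h0 : (‖v 0‖ : ℂ) ≠ 0 := by simpa using h
    have hT : (‖t‖ : ℂ) ≠ 0 := by simpa using ht
    have ht2 : starRingEnd ℂ t * t = (‖t‖ : ℂ) ^ 2 := Complex.conj_mul' t
    simp only [PiLp.smul_apply, smul_eq_mul, map_mul, norm_mul, norm_smul, Complex.ofReal_mul]
    field_simp
    linear_combination (starRingEnd ℂ (v 0)) * ht2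

lemma norm_normalizeVec (v : C2) : ‖normalizeVec v‖ = 1 := by
  unfold normalizeVec
  split_ifs with h
  · simp [EuclideanSpace.norm_eq, Fin.sum_univ_two]
  · have hv : v ≠ 0 := by rintro rfl; simp at h
    have hn : ‖v‖ ≠ 0 := by simpa using hv
    have h0 : ‖v 0‖ ≠ 0 := by simpa using h
    rw [norm_smul, norm_div, RCLike.norm_conj, Complex.norm_real, norm_mul, norm_norm, norm_norm]
    field_simp

/-- The canonical unit representative of a point of the projective line. -/
def unitRep (x : CP1) : S3 :=
  Projectivization.lift
    (fun v : {v : C2 // v ≠ 0} =>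
      (⟨normalizeVec v, mem_sphere_zero_iff_norm.mpr (norm_normalizeVec v)⟩ : S3))
    (fun a b t h => Subtype.ext (by
      have ht : t ≠ 0 := by rintro rfl; exact a.2 (by simpa using h)
      change normalizeVec a = normalizeVec b
      rw [h, normalizeVec_smul t ht])) x

lemma hopf_unitRep (x : CP1) : hopf (unitRep x) = x := by
  induction x using Projectivization.ind with
  | h v hv =>
    refine (Projectivization.mk_eq_mk_iff' ℂ _ _ _ _).mpr ?_
    change ∃ a : ℂ, a • v = normalizeVec v
    unfold normalizeVec
    split_ifs with h
    · have h1 : v 1 ≠ 0 := by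
        intro h1
        apply hv
        ext i
        fin_cases i <;> simp [h, h1]
      refine ⟨(v 1)⁻¹, ?_⟩
      ext i
      fin_cases i <;> simp [h, h1]
    · exact ⟨_, rfl⟩

lemma measurable_unitRep : Measurable unitRep := by
  have h : Measurable (fun v : {v : C2 // v ≠ 0} =>
      (⟨normalizeVec v, mem_sphere_zero_iff_norm.mpr (norm_normalizeVec v)⟩ : S3)) := by
    refine Measurable.subtype_mk ?_
    refine Measurable.comp (g := normalizeVec) ?_ measurable_subtype_coe
    have h0 : Measurable fun v : C2 => v 0 := by fun_prop
    refine Measurable.ite (h0 (measurableSet_singleton 0)) measurable_const ?_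
    have h1 : Measurable fun v : C2 => starRingEnd ℂ (v 0) :=
      Complex.continuous_conj.measurable.comp h0
    have h2 : Measurable fun v : C2 => ((‖v 0‖ * ‖v‖ : ℝ) : ℂ) :=
      Complex.measurable_ofReal.comp (h0.norm.mul measurable_norm)
    exact (h1.div h2).smul measurable_id
  exact fun S hS => h hS

/-- The kernel of the Spherical ensemble of `r` points with respect to the Fubini-Study volume:
`(r / π) ⟨p, q⟩ ^ (r - 1)` on unit representatives `p`, `q`. -/
def sphericalKernel (r : ℕ) (x y : CP1) : ℂ :=
  ((r : ℂ) / (Real.pi : ℂ)) * (inner ℂ (unitRep x : C2) (unitRep y : C2)) ^ (r - 1)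

/-- The random points `X` are sampled from the Spherical ensemble of `r` points. -/
def IsSphericalEnsemble {Ω : Type*} [MeasurableSpace Ω] (P : Measure Ω) {r : ℕ}
    (X : Fin r → Ω → CP1) : Prop :=
  IsDeterminantal fubiniStudy P (sphericalKernel r) X

end HopfSpherical

end

noncomputable section

namespace HopfSpherical

/-! ### The overlap of two points of the projective line -/

/-! Split the energy by fibres. On one fibre the points are a rotated set of `k`-th roots of unity,
whose energy is `-k log k` because the product of `1 - ζ^c` over the nontrivial roots is `k`
(`sum_log_dist_fibrePoint`).

For two fibres, average over one phase. With `c = ⟨p, q⟩`, `‖e^{it} p - q‖ = |α e^{it} - c/α|` where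
`α² = 1 + √(1 - |c|²)`. As `|c/α| ≤ α`, the mean of its logarithm over the circle is `log α`
(`intervalIntegral_log_dist_phase`). Each of the `k²` pairs of points therefore contributes
`fibrePotential` at `|c|²`, which depends only on the base points.

The ordered pairs of base points have density `(r/π)² (1 - u^(r-1))`, with `u` the overlap
(`pairMeasure_eq_withDensity`). By unitary invariance `u` is uniform on `[0, 1]` under the
normalized volume (`integral_overlap`), which leaves `r² ∫ fibrePotential u (1 - u^(r-1)) du`.
Substituting `u = 1 - s²` and integrating by parts reduces it to `∫ (1 - s²)^(r-1)`, the source of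
the Gamma quotient (`sq_mul_integral_fibrePotential`). Log-convexity of Gamma compares that quotient
with `√r` and gives the error term. -/

/-- The squared modulus of the Hermitian product of unit representatives. -/
def overlap (x y : CP1) : ℝ := ‖inner ℂ (unitRep x : C2) (unitRep y : C2)‖ ^ 2

lemma norm_S3 (p : S3) : ‖(p : C2)‖ = 1 := mem_sphere_zero_iff_norm.mp p.2

lemma norm_inner_S3_le (p q : S3) : ‖inner ℂ (p : C2) (q : C2)‖ ≤ 1 := by
  simpa [norm_S3] using norm_inner_le_norm (𝕜 := ℂ) (p : C2) (q : C2)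

lemma overlap_nonneg (x y : CP1) : 0 ≤ overlap x y := sq_nonneg _

lemma overlap_le_one (x y : CP1) : overlap x y ≤ 1 :=
  pow_le_one₀ (norm_nonneg _) (norm_inner_S3_le _ _)

lemma measurable_overlap : Measurable (Function.uncurry overlap) := by
  have h1 : Measurable fun z : CP1 × CP1 => (unitRep z.1 : C2) :=
    measurable_subtype_coe.comp (measurable_unitRep.comp measurable_fst)
  have h2 : Measurable fun z : CP1 × CP1 => (unitRep z.2 : C2) :=
    measurable_subtype_coe.comp (measurable_unitRep.comp measurable_snd)
  exact ((h1.inner h2).norm.pow_const 2)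

lemma exists_smul_of_hopf_eq {p q : S3} (h : hopf p = hopf q) :
    ∃ u : ℂ, ‖u‖ = 1 ∧ u • (q : C2) = p := by
  obtain ⟨u, hu⟩ := (Projectivization.mk_eq_mk_iff' ℂ _ _ _ _).mp h
  refine ⟨u, ?_, hu⟩
  have := congrArg norm hu
  simpa [norm_smul, norm_S3] using this

/-- Representatives differ by unit scalars. This is what makes the expectation independent of the
section `s`. -/
lemma norm_inner_eq_of_hopf_eq {p q p' q' : S3} (hp : hopf p = hopf p') (hq : hopf q = hopf q') :
    ‖inner ℂ (p : C2) (q : C2)‖ = ‖inner ℂ (p' : C2) (q' : C2)‖ := by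
  obtain ⟨u, hu, hu'⟩ := exists_smul_of_hopf_eq hp
  obtain ⟨v, hv, hv'⟩ := exists_smul_of_hopf_eq hq
  rw [← hu', ← hv', inner_smul_left, inner_smul_right]
  simp [hu, hv]

lemma norm_sq_affine (w : ℂ) : ‖(WithLp.toLp 2 ![1, w] : C2)‖ ^ 2 = 1 + ‖w‖ ^ 2 := by
  rw [EuclideanSpace.norm_sq_eq, Fin.sum_univ_two]
  simp

lemma unitRep_affineChart (w : ℂ) : (unitRep (affineChart w) : C2)
    = (((‖(WithLp.toLp 2 ![1, w] : C2)‖ : ℂ))⁻¹) • (WithLp.toLp 2 ![1, w] : C2) := by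
  change normalizeVec (WithLp.toLp 2 ![1, w]) = _
  unfold normalizeVec
  rw [if_neg (by simp)]
  simp

lemma overlap_affineChart (x : CP1) (w : ℂ) : overlap x (affineChart w)
    = ‖starRingEnd ℂ ((unitRep x : C2) 0) + starRingEnd ℂ ((unitRep x : C2) 1) * w‖ ^ 2
      / (1 + ‖w‖ ^ 2) := by
  unfold overlap
  rw [unitRep_affineChart, inner_smul_right, norm_mul, mul_pow, norm_inv, inv_pow,
    Complex.norm_real, norm_norm, norm_sq_affine, div_eq_inv_mul]
  congr 3
  simp [PiLp.inner_apply, Fin.sum_univ_two, mul_comm]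

/-! ### Change of variables -/

lemma integral_fubiniStudy (f : CP1 → ℝ) (hf : Measurable f) :
    ∫ y, f y ∂fubiniStudy = ∫ w : ℂ, (1 / (1 + ‖w‖ ^ 2) ^ 2) * f (affineChart w) := by
  rw [fubiniStudy, integral_map measurable_affineChart.aemeasurable hf.aestronglyMeasurable,
    integral_withDensity_eq_integral_toReal_smul₀ (by fun_prop) (by simp)]
  refine integral_congr_ae (Filter.Eventually.of_forall fun w => ?_)
  simp only [smul_eq_mul]
  rw [ENNReal.toReal_ofReal (by positivity)]

/-- For `u = 1/(1 + r²)` one has `|du| = 2r dr/(1 + r²)²`, so the radial Fubini–Study weight is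
exactly half of Lebesgue measure in `u`. -/
lemma integral_Ioi_inv_one_add_sq (Φ : ℝ → ℝ) :
    ∫ r in Set.Ioi (0 : ℝ), r * ((1 / (1 + r ^ 2) ^ 2) * Φ (1 / (1 + r ^ 2)))
      = (1 / 2) * ∫ u in (0 : ℝ)..1, Φ u := by
  have him : (fun r : ℝ => 1 / (1 + r ^ 2)) '' Set.Ioi 0 = Set.Ioo 0 1 := by
    ext u
    constructor
    · rintro ⟨r, hr, rfl⟩
      have hr' : 0 < r := hr
      refine ⟨by positivity, ?_⟩
      rw [div_lt_one (by positivity)]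
      nlinarith
    · rintro ⟨h0, h1⟩
      have h2 : 0 < 1 / u - 1 := by rw [sub_pos, lt_div_iff₀ h0]; linarith
      refine ⟨√(1 / u - 1), Real.sqrt_pos.mpr h2, ?_⟩
      simp only
      rw [Real.sq_sqrt h2.le]
      field_simp
      ring
  have hder : ∀ r ∈ Set.Ioi (0 : ℝ), HasDerivWithinAt (fun r : ℝ => 1 / (1 + r ^ 2))
      (-(2 * r) / (1 + r ^ 2) ^ 2) (Set.Ioi 0) r := by
    intro r _
    have h : HasDerivAt (fun r : ℝ => 1 + r ^ 2) (2 * r) r := by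
      simpa using (hasDerivAt_pow 2 r).const_add 1
    simpa only [one_div] using (h.fun_inv (by positivity)).hasDerivWithinAt
  have hinj : Set.InjOn (fun r : ℝ => 1 / (1 + r ^ 2)) (Set.Ioi 0) := by
    intro a ha b hb hab
    have ha' : 0 < a := ha
    have hb' : 0 < b := hb
    simp only [one_div, inv_inj] at hab
    nlinarith [sq_nonneg (a - b)]
  have key := integral_image_eq_integral_abs_deriv_smul measurableSet_Ioi hder hinj Φ
  rw [him] at key
  rw [intervalIntegral.integral_of_le zero_le_one, integral_Ioc_eq_integral_Ioo, key,
    ← integral_const_mul]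
  refine setIntegral_congr_fun measurableSet_Ioi fun r hr => ?_
  have hr' : 0 < r := hr
  simp only [smul_eq_mul]
  rw [abs_div, abs_neg, abs_of_pos (by positivity : (0 : ℝ) < 2 * r),
    abs_of_pos (by positivity : (0 : ℝ) < (1 + r ^ 2) ^ 2)]
  field_simp

lemma integral_complex_inv_one_add_sq (Φ : ℝ → ℝ) :
    ∫ w : ℂ, (1 / (1 + ‖w‖ ^ 2) ^ 2) * Φ (1 / (1 + ‖w‖ ^ 2))
      = Real.pi * ∫ u in (0 : ℝ)..1, Φ u := by
  rw [integral_fun_norm_addHaar (volume : Measure ℂ)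
    (fun r => (1 / (1 + r ^ 2) ^ 2) * Φ (1 / (1 + r ^ 2)))]
  simp only [Complex.finrank_real_complex, smul_eq_mul, nsmul_eq_mul, pow_one, Nat.add_one_sub_one]
  rw [integral_Ioi_inv_one_add_sq, measureReal_def, Complex.volume_ball]
  simp
  ring

/-- The linear fractional transformation induced by the unitary matrix with first column
`(a, b)`. -/
def unitaryMoebius (a b ζ : ℂ) : ℂ :=
  (b + starRingEnd ℂ a * ζ) / (a - starRingEnd ℂ b * ζ)

section Moebius

variable {a b : ℂ}

lemma conj_mul_add_conj_mul (hab : ‖a‖ ^ 2 + ‖b‖ ^ 2 = 1) :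
    starRingEnd ℂ a * a + starRingEnd ℂ b * b = 1 := by
  rw [Complex.conj_mul', Complex.conj_mul']
  exact_mod_cast hab

lemma hasDerivAt_unitaryMoebius (hab : ‖a‖ ^ 2 + ‖b‖ ^ 2 = 1) {ζ : ℂ}
    (h : a - starRingEnd ℂ b * ζ ≠ 0) :
    HasDerivAt (unitaryMoebius a b) (1 / (a - starRingEnd ℂ b * ζ) ^ 2) ζ := by
  have h1 : HasDerivAt (fun ζ : ℂ => b + starRingEnd ℂ a * ζ) (starRingEnd ℂ a) ζ := by
    simpa using ((hasDerivAt_id ζ).const_mul (starRingEnd ℂ a)).const_add b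
  have h2 : HasDerivAt (fun ζ : ℂ => a - starRingEnd ℂ b * ζ) (-starRingEnd ℂ b) ζ := by
    simpa using ((hasDerivAt_id ζ).const_mul (starRingEnd ℂ b)).const_sub a
  refine (h1.div h2 h).congr_deriv ?_
  congr 1
  linear_combination conj_mul_add_conj_mul hab

lemma conj_add_conj_mul_unitaryMoebius (hab : ‖a‖ ^ 2 + ‖b‖ ^ 2 = 1) {ζ : ℂ}
    (h : a - starRingEnd ℂ b * ζ ≠ 0) :
    starRingEnd ℂ a + starRingEnd ℂ b * unitaryMoebius a b ζ
      = 1 / (a - starRingEnd ℂ b * ζ) := by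
  unfold unitaryMoebius
  field_simp
  linear_combination conj_mul_add_conj_mul hab

lemma one_add_norm_sq_unitaryMoebius (hab : ‖a‖ ^ 2 + ‖b‖ ^ 2 = 1) {ζ : ℂ}
    (h : a - starRingEnd ℂ b * ζ ≠ 0) :
    1 + ‖unitaryMoebius a b ζ‖ ^ 2 = (1 + ‖ζ‖ ^ 2) / ‖a - starRingEnd ℂ b * ζ‖ ^ 2 := by
  have hn : ‖a - starRingEnd ℂ b * ζ‖ ≠ 0 := by simpa using h
  have key : ‖a - starRingEnd ℂ b * ζ‖ ^ 2 + ‖b + starRingEnd ℂ a * ζ‖ ^ 2 = 1 + ‖ζ‖ ^ 2 := by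
    have : ((‖a - starRingEnd ℂ b * ζ‖ ^ 2 + ‖b + starRingEnd ℂ a * ζ‖ ^ 2 : ℝ) : ℂ)
        = ((1 + ‖ζ‖ ^ 2 : ℝ) : ℂ) := by
      push_cast
      simp only [← Complex.conj_mul', map_sub, map_add, map_mul, Complex.conj_conj]
      linear_combination (1 + starRingEnd ℂ ζ * ζ) * conj_mul_add_conj_mul hab
    exact_mod_cast this
  unfold unitaryMoebius
  rw [norm_div, div_pow, ← key, add_div, div_self (pow_ne_zero 2 hn)]

lemma unitaryMoebius_inverse (hab : ‖a‖ ^ 2 + ‖b‖ ^ 2 = 1) {ζ : ℂ}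
    (h : a - starRingEnd ℂ b * ζ ≠ 0) :
    (a * unitaryMoebius a b ζ - b) / (starRingEnd ℂ a + starRingEnd ℂ b * unitaryMoebius a b ζ)
      = ζ := by
  rw [conj_add_conj_mul_unitaryMoebius hab h]
  rw [unitaryMoebius, div_div_eq_mul_div, div_one, sub_mul, mul_assoc, div_mul_cancel₀ _ h]
  linear_combination ζ * conj_mul_add_conj_mul hab

/-- Source and target each omit at most one point of the plane, so both have full measure. -/
lemma image_unitaryMoebius (hab : ‖a‖ ^ 2 + ‖b‖ ^ 2 = 1) :
    unitaryMoebius a b '' {ζ | a - starRingEnd ℂ b * ζ ≠ 0}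
      = {w | starRingEnd ℂ a + starRingEnd ℂ b * w ≠ 0} := by
  ext w
  constructor
  · rintro ⟨ζ, hζ, rfl⟩
    have h : a - starRingEnd ℂ b * ζ ≠ 0 := hζ
    rw [Set.mem_ofPred_eq, conj_add_conj_mul_unitaryMoebius hab h]
    exact one_div_ne_zero h
  · intro hw
    have hw' : starRingEnd ℂ a + starRingEnd ℂ b * w ≠ 0 := hw
    have h1 : a - starRingEnd ℂ b * ((a * w - b) / (starRingEnd ℂ a + starRingEnd ℂ b * w))
        = 1 / (starRingEnd ℂ a + starRingEnd ℂ b * w) := by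
      field_simp
      linear_combination conj_mul_add_conj_mul hab
    refine ⟨(a * w - b) / (starRingEnd ℂ a + starRingEnd ℂ b * w), ?_, ?_⟩
    · rw [Set.mem_ofPred_eq, h1]
      exact one_div_ne_zero hw'
    · rw [unitaryMoebius, h1, div_div_eq_mul_div, div_one, add_mul, mul_assoc,
        div_mul_cancel₀ _ hw']
      linear_combination w * conj_mul_add_conj_mul hab

lemma ae_affine_ne_zero {c d : ℂ} (hcd : c ≠ 0 ∨ d ≠ 0) :
    ∀ᵐ w : ℂ, c + d * w ≠ 0 := by
  rw [ae_iff]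
  refine Set.Subsingleton.measure_zero (fun x hx y hy => ?_) _
  simp only [ne_eq, not_not, Set.mem_ofPred_eq] at hx hy
  rcases eq_or_ne d 0 with rfl | hd
  · simp_all
  · exact mul_left_cancel₀ hd (by linear_combination hx - hy)

/-- The real determinant of multiplication by `c` is the field norm of `ℂ` over `ℝ`. -/
lemma det_smulRight_one_restrictScalars (c : ℂ) :
    ((ContinuousLinearMap.toSpanSingleton ℂ c).restrictScalars ℝ : ℂ →L[ℝ] ℂ).det
      = ‖c‖ ^ 2 := by
  have : (((ContinuousLinearMap.toSpanSingleton ℂ c).restrictScalars ℝ : ℂ →L[ℝ] ℂ) : ℂ →ₗ[ℝ] ℂ)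
      = LinearMap.mulLeft ℝ c := by
    ext; simp [mul_comm]
  rw [ContinuousLinearMap.det, this, ← Complex.normSq_eq_norm_sq, ← Algebra.norm_complex_apply]
  rfl

/-- Unitary invariance of the volume, in the chart. The map sends `0` to `[a : b]`; its Jacobian `|a
- b̄ζ|⁻⁴` is absorbed by the change in `(1 + |w|²)⁻²`, and the overlap with `[a : b]` becomes the
overlap with `[1 : 0]`. -/
lemma integral_unitaryMoebius (hab : ‖a‖ ^ 2 + ‖b‖ ^ 2 = 1) (Φ : ℝ → ℝ) :
    ∫ w : ℂ, (1 / (1 + ‖w‖ ^ 2) ^ 2)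
        * Φ (‖starRingEnd ℂ a + starRingEnd ℂ b * w‖ ^ 2 / (1 + ‖w‖ ^ 2))
      = ∫ ζ : ℂ, (1 / (1 + ‖ζ‖ ^ 2) ^ 2) * Φ (1 / (1 + ‖ζ‖ ^ 2)) := by
  have hne : a ≠ 0 ∨ b ≠ 0 := by
    by_contra! h
    simp [h.1, h.2] at hab
  have hS : MeasurableSet {ζ : ℂ | a - starRingEnd ℂ b * ζ ≠ 0} :=
    (isOpen_ne_fun (by fun_prop) (by fun_prop)).measurableSet
  have hder : ∀ ζ ∈ {ζ : ℂ | a - starRingEnd ℂ b * ζ ≠ 0},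
      HasFDerivWithinAt (unitaryMoebius a b)
        ((ContinuousLinearMap.toSpanSingleton ℂ
          (1 / (a - starRingEnd ℂ b * ζ) ^ 2)).restrictScalars ℝ)
        {ζ : ℂ | a - starRingEnd ℂ b * ζ ≠ 0} ζ := fun ζ hζ =>
    ((hasDerivAt_unitaryMoebius hab hζ).hasFDerivAt.restrictScalars ℝ).hasFDerivWithinAt
  have hinj : Set.InjOn (unitaryMoebius a b) {ζ : ℂ | a - starRingEnd ℂ b * ζ ≠ 0} := by
    intro x hx y hy hxy
    rw [← unitaryMoebius_inverse hab hx, hxy, unitaryMoebius_inverse hab hy]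
  have key := integral_image_eq_integral_abs_det_fderiv_smul volume hS hder hinj
    (fun w => (1 / (1 + ‖w‖ ^ 2) ^ 2)
        * Φ (‖starRingEnd ℂ a + starRingEnd ℂ b * w‖ ^ 2 / (1 + ‖w‖ ^ 2)))
  rw [image_unitaryMoebius hab, Measure.restrict_eq_self_of_ae_mem,
    setIntegral_congr_fun hS (g := fun ζ => (1 / (1 + ‖ζ‖ ^ 2) ^ 2) * Φ (1 / (1 + ‖ζ‖ ^ 2))),
    Measure.restrict_eq_self_of_ae_mem] at key
  · exact key
  · have := ae_affine_ne_zero (c := a) (d := -starRingEnd ℂ b) (by simpa using hne)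
    filter_upwards [this] with w hw
    simpa [sub_eq_add_neg] using hw
  · intro ζ hζ
    have hζ' : a - starRingEnd ℂ b * ζ ≠ 0 := hζ
    have hn : ‖a - starRingEnd ℂ b * ζ‖ ≠ 0 := by simpa using hζ'
    simp only [smul_eq_mul]
    rw [det_smulRight_one_restrictScalars, conj_add_conj_mul_unitaryMoebius hab hζ',
      one_add_norm_sq_unitaryMoebius hab hζ', abs_of_nonneg (by positivity), ← mul_assoc]
    simp only [norm_div, norm_one, norm_pow]
    congr 1
    · field_simp
    · congr 1
      field_simp
  · exact ae_affine_ne_zero (by simpa using hne)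

end Moebius

/-- The overlap with a fixed point is uniformly distributed on `[0, 1]` under the normalized
Fubini-Study volume. -/
lemma integral_overlap (x : CP1) {Φ : ℝ → ℝ} (hΦ : Measurable Φ) :
    ∫ y, Φ (overlap x y) ∂fubiniStudy = Real.pi * ∫ u in (0 : ℝ)..1, Φ u := by
  have hm : Measurable (overlap x) := measurable_overlap.of_uncurry_left
  rw [integral_fubiniStudy (fun y => Φ (overlap x y)) (hΦ.comp hm), ← integral_complex_inv_one_add_sq Φ,
    ← integral_unitaryMoebius (a := (unitRep x : C2) 0) (b := (unitRep x : C2) 1)]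
  · simp only [overlap_affineChart]
  · have := norm_S3 (unitRep x)
    rw [EuclideanSpace.norm_eq, Real.sqrt_eq_one, Fin.sum_univ_two] at this
    exact this

lemma fubiniStudy_real_univ : fubiniStudy.real Set.univ = Real.pi := by
  simpa using integral_overlap (affineChart 0) (Φ := fun _ => 1) measurable_const

instance : IsFiniteMeasure fubiniStudy := ⟨by
  refine lt_top_iff_ne_top.mpr fun h => Real.pi_ne_zero ?_
  rw [← fubiniStudy_real_univ, measureReal_def, h, ENNReal.toReal_top]⟩

/-! ### Logarithmic energy of roots of unity on a fibre -/

/-- The diagonal terms are harmless because `Real.log (1 / 0) = 0`. -/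
lemma logEnergy_eq_sum {ι E : Type*} [Fintype ι] [DecidableEq ι] [MetricSpace E] (y : ι → E) :
    logEnergy y = ∑ i, ∑ j, Real.log (1 / dist (y i) (y j)) := by
  refine Finset.sum_congr rfl fun i _ => Finset.sum_subset (Finset.filter_subset _ _) ?_
  intro j _ hj
  have : j = i := by simpa using hj
  simp [this]

lemma sum_log_norm_one_sub_pow {n : ℕ} {ζ : ℂ} (hζ : IsPrimitiveRoot ζ (n + 1)) :
    ∑ c : Fin (n + 1), Real.log ‖1 - ζ ^ (c : ℕ)‖ = Real.log ((n + 1 : ℕ) : ℝ) := by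
  have h := hζ.prod_one_sub_pow_eq_order
  rw [Fin.sum_univ_succ]
  simp only [Fin.val_zero, pow_zero, sub_self, norm_zero, Real.log_zero, zero_add, Fin.val_succ]
  rw [← Real.log_prod, ← norm_prod, Fin.prod_univ_eq_prod_range (fun c => 1 - ζ ^ (c + 1)) n, h]
  · congr 1
    exact_mod_cast Complex.norm_natCast (n + 1)
  · intro c _
    rw [norm_ne_zero_iff, sub_ne_zero]
    intro hc
    have := (hζ.pow_eq_one_iff_dvd _).mp hc.symm
    exact absurd (Nat.le_of_dvd (Nat.succ_pos _) this) (by omega)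

lemma sum_log_norm_pow_sub_pow {n : ℕ} {ζ : ℂ} (hζ : IsPrimitiveRoot ζ (n + 1))
    (a : Fin (n + 1)) :
    ∑ b : Fin (n + 1), Real.log ‖ζ ^ (a : ℕ) - ζ ^ (b : ℕ)‖ = Real.log ((n + 1 : ℕ) : ℝ) := by
  -- Rotating by `ζ^(-a)` moves the `a`-th root to `1`; subtraction in `Fin (n + 1)` is the matching
  -- cyclic reindexing.
  rw [← sum_log_norm_one_sub_pow hζ, ← Equiv.sum_comp (Equiv.subRight a)
    (fun c : Fin (n + 1) => Real.log ‖1 - ζ ^ (c : ℕ)‖)]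
  refine Finset.sum_congr rfl fun b _ => ?_
  have hb : ζ ^ (b : ℕ) = ζ ^ ((b - a : Fin (n + 1)) : ℕ) * ζ ^ (a : ℕ) := by
    conv_lhs => rw [← sub_add_cancel b a, Fin.val_add]
    rw [← pow_add, ← pow_eq_pow_mod _ hζ.pow_eq_one]
  have ha : ‖ζ ^ (a : ℕ)‖ = 1 := by
    rw [norm_pow, hζ.norm'_eq_one (Nat.succ_ne_zero n), one_pow]
  have h : ζ ^ (a : ℕ) - ζ ^ (b : ℕ)
      = (1 - ζ ^ ((b - a : Fin (n + 1)) : ℕ)) * ζ ^ (a : ℕ) := by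
    rw [hb]; ring
  rw [h, norm_mul, ha, mul_one]
  rfl

lemma dist_fibrePoint (k : ℕ) (t : ℝ) (p : S3) (a b : Fin k) :
    dist (fibrePoint k t p a) (fibrePoint k t p b)
      = ‖Complex.exp (2 * Real.pi * Complex.I / k) ^ (a : ℕ)
        - Complex.exp (2 * Real.pi * Complex.I / k) ^ (b : ℕ)‖ := by
  have h (c : Fin k) : Complex.exp (((t + 2 * Real.pi * (c : ℕ) / k : ℝ) : ℂ) * Complex.I)
      = Complex.exp (t * Complex.I) * Complex.exp (2 * Real.pi * Complex.I / k) ^ (c : ℕ) := by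
    rw [← Complex.exp_nat_mul, ← Complex.exp_add]
    congr 1
    push_cast
    ring
  rw [Subtype.dist_eq, dist_eq_norm]
  change ‖Complex.exp _ • (p : C2) - Complex.exp _ • (p : C2)‖ = _
  rw [← sub_smul, norm_smul, norm_S3, mul_one, h, h, ← mul_sub, norm_mul,
    Complex.norm_exp_ofReal_mul_I, one_mul]

/-- The logarithmic energy of `k` equidistributed points on a unit circle. -/
lemma sum_log_dist_fibrePoint {k : ℕ} (hk : 1 ≤ k) (t : ℝ) (p : S3) :
    ∑ a, ∑ b, Real.log (1 / dist (fibrePoint k t p a) (fibrePoint k t p b))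
      = -(k * Real.log k) := by
  obtain ⟨n, rfl⟩ : ∃ n, k = n + 1 := ⟨k - 1, by omega⟩
  have hζ := Complex.isPrimitiveRoot_exp (n + 1) (Nat.succ_ne_zero n)
  simp_rw [dist_fibrePoint, one_div, Real.log_inv, Finset.sum_neg_distrib,
    sum_log_norm_pow_sub_pow hζ]
  simp

/-! ### Average interaction of two fibres -/

/-- The average of `log (1 / ‖e^{it} p - q‖)` over `t`, as a function of `|⟨p, q⟩|²`. -/
def fibrePotential (u : ℝ) : ℝ := -(1 / 2) * Real.log (1 + √(1 - u))

lemma continuous_fibrePotential : Continuous fibrePotential := by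
  unfold fibrePotential
  refine continuous_const.mul (Continuous.log (by fun_prop) fun u => ?_)
  positivity

lemma abs_fibrePotential_le {u : ℝ} (hu : 0 ≤ u) : |fibrePotential u| ≤ 1 := by
  unfold fibrePotential
  have h1 : √(1 - u) ≤ 1 := Real.sqrt_le_one.mpr (by linarith)
  have h0 : 0 ≤ √(1 - u) := Real.sqrt_nonneg _
  have h2 : Real.log (1 + √(1 - u)) ≤ 1 := by
    have := Real.log_le_sub_one_of_pos (by linarith : 0 < 1 + √(1 - u))
    linarith
  have h3 : 0 ≤ Real.log (1 + √(1 - u)) := Real.log_nonneg (by linarith)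
  rw [abs_le]
  constructor <;> linarith

/-- Both squares have the same cross term, `-2 Re(e^{-it}⟨p, q⟩)`; `h` matches the constant terms.
-/
lemma dist_phase_eq (p q : S3) {α : ℝ} (hα : 0 < α)
    (h : α ^ 2 + ‖inner ℂ (p : C2) (q : C2)‖ ^ 2 / α ^ 2 = 2) (t : ℝ) :
    dist (phase t p) q = ‖circleMap 0 α t - inner ℂ (p : C2) (q : C2) / α‖ := by
  rw [Subtype.dist_eq, dist_eq_norm, ← sq_eq_sq₀ (norm_nonneg _) (norm_nonneg _)]
  change ‖Complex.exp (t * Complex.I) • (p : C2) - (q : C2)‖ ^ 2 = _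
  have hα' : (α : ℂ) ≠ 0 := by exact_mod_cast hα.ne'
  rw [norm_sub_sq (𝕜 := ℂ), norm_sub_sq (𝕜 := ℂ), inner_smul_left, norm_smul, norm_S3, norm_S3,
    Complex.norm_exp_ofReal_mul_I, circleMap_zero, norm_mul, Complex.norm_exp_ofReal_mul_I,
    Complex.norm_real, Real.norm_eq_abs, abs_of_pos hα, norm_div, Complex.norm_real,
    Real.norm_eq_abs, abs_of_pos hα, div_pow]
  have h2 : inner ℂ ((α : ℂ) * Complex.exp (t * Complex.I)) (inner ℂ (p : C2) (q : C2) / (α : ℂ))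
      = starRingEnd ℂ (Complex.exp (t * Complex.I)) * inner ℂ (p : C2) (q : C2) := by
    rw [RCLike.inner_apply, map_mul, Complex.conj_ofReal]
    field_simp
  rw [h2]
  linear_combination -h

/-- Here `α²` is the larger root of `X² - 2X + u`. That choice gives `√u ≤ α²`, which keeps `c/α` in
the closed disc of radius `α`, boundary case `|c| = 1` included. -/
lemma fibrePotential_radius {u : ℝ} (h1 : u ≤ 1) :
    ∃ α : ℝ, 0 < α ∧ α ^ 2 + u / α ^ 2 = 2 ∧ √u ≤ α ^ 2 ∧ Real.log α = -fibrePotential u := by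
  have hs : 0 ≤ √(1 - u) := Real.sqrt_nonneg _
  have hs2 : √(1 - u) ^ 2 = 1 - u := Real.sq_sqrt (by linarith)
  have hα2 : √(1 + √(1 - u)) ^ 2 = 1 + √(1 - u) := Real.sq_sqrt (by linarith)
  refine ⟨√(1 + √(1 - u)), Real.sqrt_pos.mpr (by linarith), ?_, ?_, ?_⟩
  · rw [hα2]
    field_simp
    nlinarith
  · rw [hα2]
    exact (Real.sqrt_le_one.mpr h1).trans (by linarith)
  · rw [Real.log_sqrt (by linarith), fibrePotential]
    ring

lemma intervalIntegral_log_dist_phase (p q : S3) :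
    IntervalIntegrable (fun t => Real.log (1 / dist (phase t p) q)) volume 0 (2 * Real.pi) ∧
    ∫ t in (0 : ℝ)..2 * Real.pi, Real.log (1 / dist (phase t p) q)
      = 2 * Real.pi * fibrePotential (‖inner ℂ (p : C2) (q : C2)‖ ^ 2) := by
  obtain ⟨α, hα, h1, h2, h3⟩ := fibrePotential_radius
    (pow_le_one₀ (norm_nonneg _) (norm_inner_S3_le p q))
  rw [Real.sqrt_sq (norm_nonneg _)] at h2
  simp_rw [dist_phase_eq p q hα h1, one_div, Real.log_inv]
  constructor
  · have : CircleIntegrable (fun z => Real.log ‖z - inner ℂ (p : C2) (q : C2) / (α : ℂ)‖) 0 α :=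
      MeromorphicOn.circleIntegrable_log_norm (fun _ _ ↦ by fun_prop)
    exact this.neg
  · have := circleAverage_log_norm_sub_const_of_mem_closedBall (R := α) (c := 0)
      (a := inner ℂ (p : C2) (q : C2) / (α : ℂ)) (by
        rw [mem_closedBall_zero_iff, norm_div, Complex.norm_real, Real.norm_eq_abs,
          abs_of_pos hα, div_le_iff₀ hα]
        nlinarith)
    rw [Real.circleAverage_def, h3, smul_eq_mul, inv_mul_eq_iff_eq_mul₀ (by positivity)] at this
    rw [intervalIntegral.integral_neg, this]
    ring

/-! ### The radial integral -/

lemma hasDerivAt_one_sub_sq (s : ℝ) : HasDerivAt (fun s : ℝ => 1 - s ^ 2) (-(2 * s)) s := by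
  simpa using (hasDerivAt_pow 2 s).const_sub 1

/-- Integrate the derivative of `s (1 - s²)^(n+1)`, which vanishes at both endpoints. -/
lemma integral_one_sub_sq_pow_succ (n : ℕ) :
    (2 * n + 3 : ℝ) * ∫ s in (0 : ℝ)..1, (1 - s ^ 2) ^ (n + 1)
      = (2 * n + 2 : ℝ) * ∫ s in (0 : ℝ)..1, (1 - s ^ 2) ^ n := by
  have hd : ∀ s ∈ Set.uIcc (0 : ℝ) 1, HasDerivAt (fun s : ℝ => s * (1 - s ^ 2) ^ (n + 1))
      ((2 * n + 3 : ℝ) * (1 - s ^ 2) ^ (n + 1) - (2 * n + 2 : ℝ) * (1 - s ^ 2) ^ n) s := by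
    intro s _
    refine ((hasDerivAt_id s).fun_mul ((hasDerivAt_one_sub_sq s).fun_pow (n + 1))).congr_deriv ?_
    simp only [id, Nat.add_sub_cancel, pow_succ]
    push_cast
    ring
  have h := intervalIntegral.integral_eq_sub_of_hasDerivAt hd
    (Continuous.intervalIntegrable (by fun_prop) _ _)
  rw [intervalIntegral.integral_sub (Continuous.intervalIntegrable (by fun_prop) _ _)
    (Continuous.intervalIntegrable (by fun_prop) _ _), intervalIntegral.integral_const_mul,
    intervalIntegral.integral_const_mul] at h
  simp at h
  linarith

lemma integral_one_sub_sq_pow (n : ℕ) :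
    ∫ s in (0 : ℝ)..1, (1 - s ^ 2) ^ n
      = √Real.pi * Real.Gamma (n + 1) / (2 * Real.Gamma (n + 1 + 1 / 2)) := by
  have hπ : √Real.pi ≠ 0 := by positivity
  induction n with
  | zero =>
    have : Real.Gamma (0 + 1 + 1 / 2) = 1 / 2 * √Real.pi := by
      rw [show (0 : ℝ) + 1 + 1 / 2 = 1 / 2 + 1 by norm_num, Real.Gamma_add_one (by norm_num),
        Real.Gamma_one_half_eq]
    simp only [Nat.cast_zero, this, pow_zero]
    simp
    field_simp
  | succ n ih =>
    have hG : Real.Gamma ((n : ℝ) + 1 + 1 / 2) ≠ 0 := (Real.Gamma_pos_of_pos (by positivity)).ne'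
    have h := integral_one_sub_sq_pow_succ n
    rw [ih] at h
    push_cast
    rw [Real.Gamma_add_one (s := (n : ℝ) + 1) (by positivity),
      show (n : ℝ) + 1 + 1 + 1 / 2 = (n + 1 + 1 / 2) + 1 by ring,
      Real.Gamma_add_one (s := (n : ℝ) + 1 + 1 / 2) (by positivity)]
    have h3 : (2 * n + 3 : ℝ) ≠ 0 := by positivity
    rw [← mul_right_inj' h3, h]
    field_simp
    ring

lemma integral_mul_one_sub_sq_pow (n : ℕ) :
    ∫ s in (0 : ℝ)..1, s * (1 - s ^ 2) ^ n = 1 / (2 * (n + 1 : ℝ)) := by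
  have hd : ∀ s ∈ Set.uIcc (0 : ℝ) 1, HasDerivAt
      (fun s : ℝ => -(1 / (2 * (n + 1 : ℝ))) * (1 - s ^ 2) ^ (n + 1)) (s * (1 - s ^ 2) ^ n) s := by
    intro s _
    refine (((hasDerivAt_one_sub_sq s).fun_pow (n + 1)).const_mul _).congr_deriv ?_
    simp only [Nat.add_sub_cancel]
    push_cast
    field_simp
  rw [intervalIntegral.integral_eq_sub_of_hasDerivAt hd
    (Continuous.intervalIntegrable (by fun_prop) _ _)]
  simp

lemma intervalIntegrable_mul_log_one_add (n : ℕ) :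
    IntervalIntegrable (fun s : ℝ => s * Real.log (1 + s) * (1 - s ^ 2) ^ n) volume 0 1 := by
  refine ContinuousOn.intervalIntegrable ?_
  refine ((continuousOn_id.mul (ContinuousOn.log (by fun_prop) fun s hs => ?_))).mul (by fun_prop)
  rw [Set.uIcc_of_le zero_le_one] at hs
  linarith [hs.1]

/-- Integration by parts; the logarithm disappears because `(1 - s²)^(n+1) / (1 + s) = (1 - s)(1 -
s²)^n`. -/
lemma integral_mul_log_one_add_mul_one_sub_sq_pow (n : ℕ) :
    ∫ s in (0 : ℝ)..1, s * Real.log (1 + s) * (1 - s ^ 2) ^ n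
      = ((∫ s in (0 : ℝ)..1, (1 - s ^ 2) ^ n) - 1 / (2 * (n + 1 : ℝ))) / (2 * (n + 1 : ℝ)) := by
  have hn : (n + 1 : ℝ) ≠ 0 := by positivity
  have hd : ∀ s ∈ Set.uIcc (0 : ℝ) 1, HasDerivAt
      (fun s : ℝ => -(1 / (2 * (n + 1 : ℝ))) * (1 - s ^ 2) ^ (n + 1) * Real.log (1 + s))
      (s * Real.log (1 + s) * (1 - s ^ 2) ^ n
        - 1 / (2 * (n + 1)) * ((1 - s ^ 2) ^ n - s * (1 - s ^ 2) ^ n)) s := by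
    intro s hs
    rw [Set.uIcc_of_le zero_le_one] at hs
    have hs1 : 1 + s ≠ 0 := by linarith [hs.1]
    have hl : HasDerivAt (fun s : ℝ => Real.log (1 + s)) (1 / (1 + s)) s :=
      ((hasDerivAt_id s).const_add 1).log hs1
    refine ((((hasDerivAt_one_sub_sq s).fun_pow (n + 1)).const_mul
      (-(1 / (2 * (n + 1 : ℝ))))).fun_mul hl).congr_deriv ?_
    simp only [Nat.add_sub_cancel, pow_succ]
    push_cast
    field_simp
    ring
  have hi : IntervalIntegrable
      (fun s : ℝ => 1 / (2 * (n + 1 : ℝ)) * ((1 - s ^ 2) ^ n - s * (1 - s ^ 2) ^ n))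
      volume 0 1 := Continuous.intervalIntegrable (by fun_prop) _ _
  have h := intervalIntegral.integral_eq_sub_of_hasDerivAt hd
    ((intervalIntegrable_mul_log_one_add n).sub hi)
  rw [intervalIntegral.integral_sub (intervalIntegrable_mul_log_one_add n) hi,
    intervalIntegral.integral_const_mul, intervalIntegral.integral_sub
    (Continuous.intervalIntegrable (by fun_prop) _ _)
    (Continuous.intervalIntegrable (by fun_prop) _ _), integral_mul_one_sub_sq_pow] at h
  simp only [one_pow, sub_self, ne_eq, Nat.succ_ne_zero, not_false_eq_true, zero_pow, mul_zero,
    zero_mul, add_zero, Real.log_one] at h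
  rw [sub_eq_zero.mp h]
  ring

/-- Substitution `u = 1 - s²`, where `√(1 - u) = s`. The power `0` is kept so that one formula
evaluates both integrals. -/
lemma integral_fibrePotential_mul (n : ℕ) :
    ∫ u in (0 : ℝ)..1, fibrePotential u * (1 - u ^ n)
      = (∫ s in (0 : ℝ)..1, s * Real.log (1 + s) * (1 - s ^ 2) ^ n)
        - ∫ s in (0 : ℝ)..1, s * Real.log (1 + s) * (1 - s ^ 2) ^ 0 := by
  have hc : Continuous fun u : ℝ => fibrePotential u * (1 - u ^ n) :=
    continuous_fibrePotential.mul (by fun_prop)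
  have h := intervalIntegral.integral_comp_mul_deriv (a := 0) (b := 1)
    (fun s _ => hasDerivAt_one_sub_sq s) (by fun_prop) hc
  simp only [ne_eq, OfNat.ofNat_ne_zero, not_false_eq_true, zero_pow, sub_zero, one_pow,
    sub_self] at h
  rw [intervalIntegral.integral_symm, ← h, ← intervalIntegral.integral_neg,
    ← intervalIntegral.integral_sub (intervalIntegrable_mul_log_one_add n)
      (intervalIntegrable_mul_log_one_add 0)]
  refine intervalIntegral.integral_congr fun s hs => ?_
  rw [Set.uIcc_of_le zero_le_one] at hs
  simp only [Function.comp_apply, fibrePotential, sub_sub_cancel, Real.sqrt_sq hs.1]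
  ring

lemma sq_mul_integral_fibrePotential {r : ℕ} (hr : 1 ≤ r) :
    (r : ℝ) ^ 2 * ∫ u in (0 : ℝ)..1, fibrePotential u * (1 - u ^ (r - 1))
      = -(r : ℝ) ^ 2 / 4 + √Real.pi * Real.Gamma ((r : ℝ) + 1) / (4 * Real.Gamma ((r : ℝ) + 1 / 2))
        - 1 / 4 := by
  obtain ⟨n, rfl⟩ : ∃ n, r = n + 1 := ⟨r - 1, by omega⟩
  have hG : Real.Gamma ((n : ℝ) + 1 + 1 / 2) ≠ 0 := (Real.Gamma_pos_of_pos (by positivity)).ne'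
  have hn : (n + 1 : ℝ) ≠ 0 := by positivity
  rw [Nat.add_sub_cancel, integral_fibrePotential_mul,
    integral_mul_log_one_add_mul_one_sub_sq_pow, integral_mul_log_one_add_mul_one_sub_sq_pow,
    integral_one_sub_sq_pow]
  push_cast
  rw [Real.Gamma_add_one (s := (n : ℝ) + 1) hn]
  simp
  field_simp
  ring

/-! ### Asymptotics of the Gamma quotient -/

/-- Log-convexity of Gamma at the midpoint of `a` and `a + 1`. -/
lemma Gamma_sq_le {a : ℝ} (ha : 0 < a) :
    Real.Gamma (a + 1 / 2) ^ 2 ≤ Real.Gamma a * Real.Gamma (a + 1) := by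
  have h := Real.Gamma_mul_add_mul_le_rpow_Gamma_mul_rpow_Gamma (s := a) (t := a + 1)
    (a := 1 / 2) (b := 1 / 2) ha (by linarith) (by norm_num) (by norm_num) (by norm_num)
  rw [show 1 / 2 * a + 1 / 2 * (a + 1) = a + 1 / 2 by ring, ← Real.sqrt_eq_rpow,
    ← Real.sqrt_eq_rpow] at h
  have h1 := Real.Gamma_pos_of_pos ha
  have h2 := Real.Gamma_pos_of_pos (by linarith : 0 < a + 1)
  have h3 := Real.Gamma_pos_of_pos (by linarith : 0 < a + 1 / 2)
  calc Real.Gamma (a + 1 / 2) ^ 2 ≤ (√(Real.Gamma a) * √(Real.Gamma (a + 1))) ^ 2 := by gcongr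
    _ = _ := by rw [mul_pow, Real.sq_sqrt h1.le, Real.sq_sqrt h2.le]

lemma abs_Gamma_quotient_sub_sqrt_le {x : ℝ} (hx : 0 < x) :
    |Real.Gamma (x + 1) / Real.Gamma (x + 1 / 2) - √x| ≤ 1 / √x := by
  have h1 := Real.Gamma_pos_of_pos hx
  have h2 := Real.Gamma_pos_of_pos (by linarith : 0 < x + 1)
  have h3 := Real.Gamma_pos_of_pos (by linarith : 0 < x + 1 / 2)
  have hs : 0 < √x := Real.sqrt_pos.mpr hx
  have hs2 : √x ^ 2 = x := Real.sq_sqrt hx.le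
  have hq : 0 < Real.Gamma (x + 1) / Real.Gamma (x + 1 / 2) := div_pos h2 h3
  -- Midpoint convexity at `x` gives the lower bound, and at `x + 1/2` the upper one. Then `(q -
  -- √x)√x ≤ q² - x ≤ 1/2`.
  have hlow : x ≤ (Real.Gamma (x + 1) / Real.Gamma (x + 1 / 2)) ^ 2 := by
    rw [div_pow, le_div_iff₀ (by positivity)]
    have := Gamma_sq_le hx
    have h4 := Real.Gamma_add_one hx.ne'
    calc x * Real.Gamma (x + 1 / 2) ^ 2 ≤ x * (Real.Gamma x * Real.Gamma (x + 1)) := by gcongr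
      _ = Real.Gamma (x + 1) ^ 2 := by rw [h4]; ring
  have hup : (Real.Gamma (x + 1) / Real.Gamma (x + 1 / 2)) ^ 2 ≤ x + 1 / 2 := by
    rw [div_pow, div_le_iff₀ (by positivity)]
    have := Gamma_sq_le (by linarith : 0 < x + 1 / 2)
    rw [Real.Gamma_add_one (s := x + 1 / 2) (by positivity),
      show x + 1 / 2 + 1 / 2 = x + 1 by ring] at this
    linarith
  set q := Real.Gamma (x + 1) / Real.Gamma (x + 1 / 2)
  have hlow' : √x ≤ q := Real.sqrt_le_iff.mpr ⟨hq.le, hlow⟩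
  rw [abs_of_nonneg (by linarith), le_div_iff₀ hs]
  nlinarith

/-! ### Measures on a square determined by disjoint rectangles -/

/-- Intensities only see disjoint rectangles. The countably many rectangles `S n ×ˢ (S n)ᶜ` cover
the complement of the diagonal, and any rectangle meets each of them in a product of disjoint sets.
-/
lemma measure_prod_ext_of_disjoint {Λ ι : Type*} [MeasurableSpace Λ] [Countable ι]
    {μ ν : Measure (Λ × Λ)} [IsFiniteMeasure μ] (S : ι → Set Λ)
    (hS : ∀ n, MeasurableSet (S n)) (hsep : ∀ x y, x ≠ y → ∃ n, x ∈ S n ∧ y ∉ S n)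
    (hμ : ∀ᵐ z ∂μ, z.1 ≠ z.2) (hν : ∀ᵐ z ∂ν, z.1 ≠ z.2)
    (h : ∀ A B, MeasurableSet A → MeasurableSet B → Disjoint A B → μ (A ×ˢ B) = ν (A ×ˢ B)) :
    μ = ν := by
  have hcov {m : Measure (Λ × Λ)} (hm : ∀ᵐ z ∂m, z.1 ≠ z.2) :
      m.restrict (⋃ n, S n ×ˢ (S n)ᶜ) = m := by
    refine Measure.restrict_eq_self_of_ae_mem ?_
    filter_upwards [hm] with z hz
    obtain ⟨n, h1, h2⟩ := hsep _ _ hz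
    exact Set.mem_iUnion.mpr ⟨n, h1, h2⟩
  rw [← hcov hμ, ← hcov hν, Measure.restrict_iUnion_congr]
  intro n
  refine Measure.ext_prod fun {A B} hA hB => ?_
  rw [Measure.restrict_apply (hA.prod hB), Measure.restrict_apply (hA.prod hB),
    Set.prod_inter_prod]
  exact h _ _ (hA.inter (hS n)) (hB.inter (hS n).compl)
    (disjoint_compl_right.mono Set.inter_subset_right Set.inter_subset_right)

lemma unitRep_injective : Function.Injective unitRep :=
  Function.LeftInverse.injective hopf_unitRep

lemma measurableSet_off_diagonal : MeasurableSet {z : CP1 × CP1 | z.1 ≠ z.2} := by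
  have : {z : CP1 × CP1 | z.1 ≠ z.2} = {z | unitRep z.1 = unitRep z.2}ᶜ := by
    ext z
    simp [unitRep_injective.eq_iff]
  rw [this]
  exact (measurableSet_eq_fun (measurable_unitRep.comp measurable_fst)
    (measurable_unitRep.comp measurable_snd)).compl

lemma measure_CP1_prod_ext_of_disjoint {μ ν : Measure (CP1 × CP1)} [IsFiniteMeasure μ]
    (hμ : ∀ᵐ z ∂μ, z.1 ≠ z.2) (hν : ∀ᵐ z ∂ν, z.1 ≠ z.2)
    (h : ∀ A B, MeasurableSet A → MeasurableSet B → Disjoint A B → μ (A ×ˢ B) = ν (A ×ˢ B)) :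
    μ = ν := by
  have hb := TopologicalSpace.isBasis_countableBasis S3
  have := (TopologicalSpace.countable_countableBasis S3).to_subtype
  refine measure_prod_ext_of_disjoint
    (fun b : TopologicalSpace.countableBasis S3 => unitRep ⁻¹' (b : Set S3))
    (fun b => measurable_unitRep (hb.isOpen b.2).measurableSet) (fun x y hxy => ?_) hμ hν h
  obtain ⟨b, hb1, hb2, hb3⟩ := hb.exists_subset_of_mem_open
    (show unitRep x ∈ ({unitRep y}ᶜ : Set S3) by simpa [unitRep_injective.eq_iff] using hxy)
    isOpen_compl_singleton
  exact ⟨⟨b, hb1⟩, hb2, fun hy => hb3 hy rfl⟩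

/-! ### Law of the ordered pairs of a spherical ensemble -/

/-- The two-point intensity of the spherical ensemble. -/
def pairDensity (r : ℕ) (z : CP1 × CP1) : ℝ :=
  ((r : ℝ) / Real.pi) ^ 2 * (1 - overlap z.1 z.2 ^ (r - 1))

lemma measurable_overlap_prod : Measurable fun z : CP1 × CP1 => overlap z.1 z.2 :=
  measurable_overlap

lemma measurable_pairDensity (r : ℕ) : Measurable (pairDensity r) :=
  ((measurable_overlap_prod.pow_const _).const_sub _).const_mul _

lemma pairDensity_nonneg (r : ℕ) (z : CP1 × CP1) : 0 ≤ pairDensity r z :=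
  mul_nonneg (sq_nonneg _) (sub_nonneg.mpr (pow_le_one₀ (overlap_nonneg _ _) (overlap_le_one _ _)))

lemma pairDensity_le (r : ℕ) (z : CP1 × CP1) : pairDensity r z ≤ ((r : ℝ) / Real.pi) ^ 2 :=
  mul_le_of_le_one_right (sq_nonneg _) (sub_le_self _ (pow_nonneg (overlap_nonneg _ _) _))

lemma inner_unitRep_self (x : CP1) : inner ℂ (unitRep x : C2) (unitRep x : C2) = 1 := by
  rw [inner_self_eq_norm_sq_to_K, norm_S3]
  simp

lemma overlap_self (x : CP1) : overlap x x = 1 := by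
  rw [overlap, inner_unitRep_self]
  simp

lemma pairDensity_diagonal (r : ℕ) (x : CP1) : pairDensity r (x, x) = 0 := by
  simp [pairDensity, overlap_self]

lemma det_sphericalKernel (r : ℕ) (x : Fin 2 → CP1) :
    (Matrix.of fun i j => sphericalKernel r (x i) (x j)).det
      = ((pairDensity r (x 0, x 1) : ℝ) : ℂ) := by
  rw [Matrix.det_fin_two]
  simp only [Matrix.of_apply, sphericalKernel, inner_unitRep_self, one_pow, mul_one, pairDensity,
    overlap]
  rw [← inner_conj_symm (unitRep (x 1) : C2) (unitRep (x 0) : C2)]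
  push_cast
  rw [← Complex.mul_conj']
  ring

section PairLaw

variable {Ω : Type*} [MeasurableSpace Ω] {P : Measure Ω} {r : ℕ} {X : Fin r → Ω → CP1}

/-- The sum of the laws of `(X i, X j)` over ordered pairs `i ≠ j`. -/
def pairMeasure (P : Measure Ω) (X : Fin r → Ω → CP1) : Measure (CP1 × CP1) :=
  ∑ i, ∑ j ∈ Finset.univ.filter (fun j => j ≠ i), P.map fun ω => (X i ω, X j ω)

lemma countIn_eq_sum_indicator {Λ : Type*} {n : ℕ} (x : Fin n → Λ) (D : Set Λ) :
    (countIn x D : ℝ≥0∞) = ∑ i, D.indicator 1 (x i) := by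
  classical
  have : {i | x i ∈ D} = ((Finset.univ.filter fun i => x i ∈ D : Finset (Fin n)) : Set (Fin n)) := by
    ext; simp
  rw [countIn, this, Set.ncard_coe_finset, Finset.card_filter]
  push_cast
  refine Finset.sum_congr rfl fun i _ => ?_
  simp [Set.indicator_apply]

lemma lintegral_countIn_mul_countIn (hX : ∀ i, Measurable (X i)) {A B : Set CP1}
    (hA : MeasurableSet A) (hB : MeasurableSet B) (hAB : Disjoint A B) :
    ∫⁻ ω, (countIn (fun i => X i ω) A : ℝ≥0∞) * countIn (fun i => X i ω) B ∂P
      = pairMeasure P X (A ×ˢ B) := by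
  have hpt (ω : Ω) : (countIn (fun i => X i ω) A : ℝ≥0∞) * countIn (fun i => X i ω) B
      = ∑ i, ∑ j ∈ Finset.univ.filter (fun j => j ≠ i),
        (((fun ω => (X i ω, X j ω)) ⁻¹' (A ×ˢ B)).indicator 1 ω : ℝ≥0∞) := by
    rw [countIn_eq_sum_indicator, countIn_eq_sum_indicator, Finset.sum_mul_sum]
    refine Finset.sum_congr rfl fun i _ => ?_
    have hmul (j : Fin r) : (A.indicator 1 (X i ω) * B.indicator 1 (X j ω) : ℝ≥0∞)
        = ((fun ω => (X i ω, X j ω)) ⁻¹' (A ×ˢ B)).indicator 1 ω := by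
      by_cases h1 : X i ω ∈ A <;> by_cases h2 : X j ω ∈ B <;> simp [h1, h2]
    simp_rw [hmul]
    -- Disjointness of `A` and `B` removes the terms `i = j`.
    refine (Finset.sum_subset (Finset.filter_subset _ _) fun j _ hj => ?_).symm
    obtain rfl : j = i := by simpa using hj
    refine Set.indicator_of_notMem (fun h => ?_) _
    exact Set.disjoint_left.mp hAB h.1 h.2
  have hm (i j : Fin r) : MeasurableSet ((fun ω => (X i ω, X j ω)) ⁻¹' (A ×ˢ B)) :=
    ((hX i).prodMk (hX j)) (hA.prod hB)
  simp_rw [hpt]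
  rw [lintegral_finsetSum _ fun i _ => Finset.measurable_sum _ fun j _ =>
    measurable_one.indicator (hm i j), pairMeasure, Measure.finsetSum_apply]
  refine Finset.sum_congr rfl fun i _ => ?_
  rw [lintegral_finsetSum _ fun j _ => measurable_one.indicator (hm i j),
    Measure.finsetSum_apply]
  refine Finset.sum_congr rfl fun j _ => ?_
  rw [lintegral_indicator_one (hm i j),
    Measure.map_apply ((hX i).prodMk (hX j)) (hA.prod hB)]

lemma pairMeasure_prod_of_disjoint (hE : IsSphericalEnsemble P X) (hr : 2 ≤ r) {A B : Set CP1}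
    (hA : MeasurableSet A) (hB : MeasurableSet B) (hAB : Disjoint A B) :
    pairMeasure P X (A ×ˢ B) = ((fubiniStudy.prod fubiniStudy).withDensity
      fun z => ENNReal.ofReal (pairDensity r z)) (A ×ˢ B) := by
  obtain ⟨ρ, hρ, hdet⟩ := hE.intensity 2 one_le_two hr
  have hρ' (y : Fin 2 → CP1) : (ρ y : ℝ≥0∞) = ENNReal.ofReal (pairDensity r (y 0, y 1)) := by
    have := hdet y
    rw [det_sphericalKernel] at this
    rw [← Complex.ofReal_injective this, ENNReal.ofReal_coe_nnreal]
  have h := hρ.lintegral_prod ![A, B] (by simp [Fin.forall_fin_two, hA, hB]) (by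
    intro i j hij
    fin_cases i <;> fin_cases j <;> simp_all [Function.onFun, disjoint_comm])
  simp only [Fin.prod_univ_two, Matrix.cons_val_zero, Matrix.cons_val_one] at h
  rw [lintegral_countIn_mul_countIn hE.measurable_points hA hB hAB] at h
  have hpre : Set.univ.pi ![A, B] = (MeasurableEquiv.finTwoArrow : (Fin 2 → CP1) ≃ᵐ CP1 × CP1) ⁻¹'
      (A ×ˢ B) := by
    ext y
    simp [Fin.forall_fin_two, MeasurableEquiv.finTwoArrow]
  rw [h, withDensity_apply _ (hA.prod hB), hpre,
    ← (measurePreserving_finTwoArrow fubiniStudy).setLIntegral_comp_preimage (hA.prod hB)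
      (measurable_pairDensity r).ennreal_ofReal]
  simp_rw [hρ']
  rfl

instance [IsFiniteMeasure P] : IsFiniteMeasure (pairMeasure P X) := by
  unfold pairMeasure
  infer_instance

/-- The second factorial moment measure of the spherical ensemble. -/
lemma pairMeasure_eq_withDensity [IsFiniteMeasure P] (hE : IsSphericalEnsemble P X)
    (hr : 1 ≤ r) :
    pairMeasure P X = (fubiniStudy.prod fubiniStudy).withDensity
      fun z => ENNReal.ofReal (pairDensity r z) := by
  rcases hr.eq_or_lt with rfl | hr
  -- For `r = 1` no two-point intensity is supplied, but both sides vanish: there are no pairs, and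
  -- `1 - u^0 = 0`.
  · have h1 : pairMeasure P X = 0 := by
      unfold pairMeasure
      refine Finset.sum_eq_zero fun i _ => ?_
      rw [Finset.filter_false_of_mem fun j _ => by simp [Subsingleton.elim j i],
        Finset.sum_empty]
    have h2 : (fun z => ENNReal.ofReal (pairDensity 1 z)) = 0 := by
      ext z
      simp [pairDensity]
    rw [h1, h2, withDensity_zero]
  · refine measure_CP1_prod_ext_of_disjoint ?_ ?_
      fun A B hA hB hAB => pairMeasure_prod_of_disjoint hE hr hA hB hAB
    · rw [pairMeasure, ae_iff, Measure.finsetSum_apply]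
      refine Finset.sum_eq_zero fun i _ => ?_
      rw [Measure.finsetSum_apply]
      refine Finset.sum_eq_zero fun j hj => ?_
      rw [← ae_iff, ae_map_iff ((hE.measurable_points i).prodMk
        (hE.measurable_points j)).aemeasurable measurableSet_off_diagonal]
      filter_upwards [hE.simple] with ω hω h
      exact (Finset.mem_filter.mp hj).2 (hω h).symm
    · rw [ae_withDensity_iff (measurable_pairDensity r).ennreal_ofReal]
      refine Filter.Eventually.of_forall fun z hz h => hz ?_
      obtain ⟨x, y⟩ := z
      obtain rfl : x = y := h
      simp [pairDensity_diagonal]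

lemma integrable_fibrePotential_overlap (μ : Measure (CP1 × CP1)) [IsFiniteMeasure μ] :
    Integrable (fun z : CP1 × CP1 => fibrePotential (overlap z.1 z.2)) μ :=
  Integrable.of_bound
    (continuous_fibrePotential.measurable.comp measurable_overlap_prod).aestronglyMeasurable 1
    (Filter.Eventually.of_forall fun _ => abs_fibrePotential_le (overlap_nonneg _ _))

lemma integral_pairMeasure_fibrePotential [IsFiniteMeasure P] (hE : IsSphericalEnsemble P X)
    (hr : 1 ≤ r) :
    ∫ z, fibrePotential (overlap z.1 z.2) ∂pairMeasure P X
      = (r : ℝ) ^ 2 * ∫ u in (0 : ℝ)..1, fibrePotential u * (1 - u ^ (r - 1)) := by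
  have hm : Measurable fun u : ℝ => fibrePotential u * (1 - u ^ (r - 1)) :=
    (continuous_fibrePotential.mul (by fun_prop)).measurable
  rw [pairMeasure_eq_withDensity hE hr, integral_withDensity_eq_integral_toReal_smul
    (measurable_pairDensity r).ennreal_ofReal (by simp)]
  simp_rw [ENNReal.toReal_ofReal (pairDensity_nonneg _ _), smul_eq_mul]
  have hi : Integrable (fun z : CP1 × CP1 => pairDensity r z * fibrePotential (overlap z.1 z.2))
      (fubiniStudy.prod fubiniStudy) := by
    refine (integrable_fibrePotential_overlap _).bdd_mul (c := ((r : ℝ) / Real.pi) ^ 2)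
      (measurable_pairDensity r).aestronglyMeasurable (Filter.Eventually.of_forall fun z => ?_)
    rw [Real.norm_eq_abs, abs_of_nonneg (pairDensity_nonneg _ _)]
    exact pairDensity_le _ _
  rw [integral_prod _ hi]
  -- The inner integral does not depend on `x`, so the outer one contributes a second factor `π`,
  -- cancelling the `π²` of the density.
  have hinner (x : CP1) : ∫ y, pairDensity r (x, y) * fibrePotential (overlap x y) ∂fubiniStudy
      = ((r : ℝ) / Real.pi) ^ 2
        * (Real.pi * ∫ u in (0 : ℝ)..1, fibrePotential u * (1 - u ^ (r - 1))) := by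
    rw [← integral_overlap x hm, ← integral_const_mul]
    refine integral_congr_ae (Filter.Eventually.of_forall fun y => ?_)
    simp only [pairDensity]
    ring
  simp_rw [hinner]
  rw [integral_const, fubiniStudy_real_univ, smul_eq_mul]
  field_simp

end PairLaw

/-! ### Averaging over the phases -/

/-- The logarithmic singularity is one-sided: `F ≥ -M` gives `|F| ≤ F + 2M`, so an upper bound on
the partial integrals suffices for absolute integrability. -/
lemma integrable_prod_of_bddBelow {α β : Type*} [MeasurableSpace α] [MeasurableSpace β]
    {μ : Measure α} {ν : Measure β} [IsFiniteMeasure μ] [IsProbabilityMeasure ν]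
    {F : α × β → ℝ} {g : α → ℝ} {M B : ℝ} (hF : Measurable F) (hM : 0 ≤ M)
    (hFM : ∀ z, -M ≤ F z) (hint : ∀ x, Integrable (fun y => F (x, y)) ν)
    (hg : ∀ x, ∫ y, F (x, y) ∂ν = g x) (hB : ∀ x, g x ≤ B) :
    Integrable F (μ.prod ν) ∧ ∫ z, F z ∂μ.prod ν = ∫ x, g x ∂μ := by
  have hi : Integrable F (μ.prod ν) := by
    rw [integrable_prod_iff hF.aestronglyMeasurable]
    refine ⟨Filter.Eventually.of_forall hint, Integrable.of_bound
      hF.aestronglyMeasurable.norm.integral_prod_right' (B + 2 * M)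
      (Filter.Eventually.of_forall fun x => ?_)⟩
    rw [Real.norm_eq_abs, abs_of_nonneg (integral_nonneg fun _ => norm_nonneg _)]
    calc ∫ y, ‖F (x, y)‖ ∂ν ≤ ∫ y, (F (x, y) + 2 * M) ∂ν := by
          refine integral_mono (hint x).norm ((hint x).add (integrable_const _)) fun y => ?_
          have := hFM (x, y)
          exact abs_le.mpr ⟨by linarith, by linarith⟩
      _ = g x + 2 * M := by
          rw [integral_add (hint x) (integrable_const _), hg]
          simp
      _ ≤ B + 2 * M := by linarith [hB x]
  refine ⟨hi, ?_⟩
  rw [integral_prod _ hi]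
  simp_rw [hg]

/-- The uniform distribution on `[0, 2π]`. -/
def uniformPhase : Measure ℝ := cond volume (Set.Icc 0 (2 * Real.pi))

instance : IsProbabilityMeasure uniformPhase :=
  cond_isProbabilityMeasure_of_finite (by simp [Real.pi_pos])
    measure_Icc_lt_top.ne

lemma uniformPhase_eq : uniformPhase
    = ENNReal.ofReal (2 * Real.pi)⁻¹ • volume.restrict (Set.Ioc 0 (2 * Real.pi)) := by
  rw [uniformPhase, ProbabilityTheory.cond, Real.volume_Icc, sub_zero, ENNReal.ofReal_inv_of_pos (by positivity),
    restrict_Ioc_eq_restrict_Icc]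

lemma integrable_uniformPhase {f : ℝ → ℝ}
    (hf : IntervalIntegrable f volume 0 (2 * Real.pi)) : Integrable f uniformPhase := by
  rw [uniformPhase_eq]
  exact (hf.1).integrable.smul_measure ENNReal.ofReal_ne_top

lemma integral_uniformPhase (f : ℝ → ℝ) :
    ∫ t, f t ∂uniformPhase = (2 * Real.pi)⁻¹ * ∫ t in (0 : ℝ)..2 * Real.pi, f t := by
  rw [uniformPhase_eq, integral_smul_measure, ENNReal.toReal_ofReal (by positivity),
    intervalIntegral.integral_of_le (by positivity), smul_eq_mul]

lemma phase_add (a b : ℝ) (p : S3) : phase (a + b) p = phase a (phase b p) := by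
  refine Subtype.ext ?_
  change Complex.exp _ • (p : C2) = Complex.exp _ • Complex.exp _ • (p : C2)
  rw [smul_smul, ← Complex.exp_add]
  congr 2
  push_cast
  ring

lemma hopf_phase (t : ℝ) (p : S3) : hopf (phase t p) = hopf p :=
  (Projectivization.mk_eq_mk_iff' ℂ _ _ _ _).mpr ⟨_, rfl⟩

lemma continuous_phase : Continuous fun z : ℝ × S3 => phase z.1 z.2 := by
  refine Continuous.subtype_mk ?_ _
  fun_prop

lemma measurable_phase : Measurable fun z : ℝ × S3 => phase z.1 z.2 :=
  continuous_phase.measurable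

lemma overlap_eq_of_hopf_eq {p q : S3} {x y : CP1} (hp : hopf p = x) (hq : hopf q = y) :
    ‖inner ℂ (p : C2) (q : C2)‖ ^ 2 = overlap x y := by
  rw [overlap, norm_inner_eq_of_hopf_eq (hp.trans (hopf_unitRep x).symm)
    (hq.trans (hopf_unitRep y).symm)]

lemma neg_two_le_log_one_div_dist (p q : S3) : -2 ≤ Real.log (1 / dist p q) := by
  rw [one_div, Real.log_inv]
  have h1 := Real.log_le_self (dist_nonneg (x := p) (y := q))
  have h2 : dist p q ≤ 2 := by
    rw [Subtype.dist_eq, dist_eq_norm]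
    have := norm_sub_le (p : C2) (q : C2)
    rw [norm_S3, norm_S3] at this
    linarith
  linarith

/-- The interaction of the `a`-th point on the fibre over `z.1.1` with phase `z.2.2` and the
`b`-th point on the fibre over `z.1.2` with phase `z.2.1`. -/
def interaction (k : ℕ) (s : CP1 → S3) (a b : Fin k) (z : (CP1 × CP1) × (ℝ × ℝ)) : ℝ :=
  Real.log (1 / dist (fibrePoint k z.2.2 (s z.1.1) a) (fibrePoint k z.2.1 (s z.1.2) b))

section Interaction

variable {k : ℕ} {s : CP1 → S3}

lemma measurable_fibrePoint {γ : Type*} [MeasurableSpace γ] {t : γ → ℝ} {p : γ → S3}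
    (ht : Measurable t) (hp : Measurable p) (a : Fin k) :
    Measurable fun c => fibrePoint k (t c) (p c) a :=
  measurable_phase.comp ((ht.add_const _).prodMk hp)

lemma measurable_interaction (hs : Measurable s) (a b : Fin k) :
    Measurable (interaction k s a b) := by
  refine Real.measurable_log.comp (measurable_const.div (Measurable.dist ?_ ?_))
  · exact measurable_fibrePoint (by fun_prop) (hs.comp (by fun_prop)) a
  · exact measurable_fibrePoint (by fun_prop) (hs.comp (by fun_prop)) b

/-- Averaging over the first point's phase alone is enough: `t'`, `a` and `b` only move points along
fibres, which leaves the overlap unchanged. Hence that phase is the last, innermost coordinate. -/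
lemma integral_log_dist_fibrePoint_phase (hsec : ∀ x, hopf (s x) = x) (a b : Fin k) (x y : CP1)
    (t' : ℝ) :
    Integrable (fun t => interaction k s a b ((x, y), (t', t))) uniformPhase ∧
    ∫ t, interaction k s a b ((x, y), (t', t)) ∂uniformPhase = fibrePotential (overlap x y) := by
  obtain ⟨h1, h2⟩ := intervalIntegral_log_dist_phase
    (phase (2 * Real.pi * (a : ℕ) / k) (s x)) (fibrePoint k t' (s y) b)
  have h (t : ℝ) : interaction k s a b ((x, y), (t', t))
      = Real.log (1 / dist (phase t (phase (2 * Real.pi * (a : ℕ) / k) (s x)))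
        (fibrePoint k t' (s y) b)) := by
    rw [← phase_add]
    rfl
  simp_rw [h]
  refine ⟨integrable_uniformPhase h1, ?_⟩
  rw [integral_uniformPhase, h2, overlap_eq_of_hopf_eq ((hopf_phase _ _).trans (hsec x))
    (q := fibrePoint k t' (s y) b) ((hopf_phase _ _).trans (hsec y))]
  field_simp

lemma integral_interaction (hs : Measurable s) (hsec : ∀ x, hopf (s x) = x) (a b : Fin k)
    (L : Measure (CP1 × CP1)) [IsFiniteMeasure L] :
    Integrable (interaction k s a b) (L.prod (uniformPhase.prod uniformPhase)) ∧
    ∫ z, interaction k s a b z ∂L.prod (uniformPhase.prod uniformPhase)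
      = ∫ z, fibrePotential (overlap z.1 z.2) ∂L := by
  have hm := measurable_interaction hs a b
  have hlow (z) : -2 ≤ interaction k s a b z := neg_two_le_log_one_div_dist _ _
  have hle (z : CP1 × CP1) : fibrePotential (overlap z.1 z.2) ≤ 1 :=
    (abs_le.mp (abs_fibrePotential_le (overlap_nonneg _ _))).2
  have hin (z : CP1 × CP1) := integrable_prod_of_bddBelow (μ := uniformPhase) (ν := uniformPhase)
    (F := fun w => interaction k s a b (z, w)) (g := fun _ => fibrePotential (overlap z.1 z.2))
    (hm.comp measurable_prodMk_left) zero_le_two (fun w => hlow (z, w))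
    (fun t' => (integral_log_dist_fibrePoint_phase hsec a b z.1 z.2 t').1)
    (fun t' => (integral_log_dist_fibrePoint_phase hsec a b z.1 z.2 t').2) (fun _ => hle z)
  exact integrable_prod_of_bddBelow hm zero_le_two hlow (fun z => (hin z).1)
    (fun z => (hin z).2.trans (by simp)) hle

end Interaction

/-! ### Expected energy -/

section Expectation

variable {Ω : Type*} [MeasurableSpace Ω] {P : Measure Ω} [IsProbabilityMeasure P] {r : ℕ}
  {X : Fin r → Ω → CP1} {θ : Fin r → Ω → ℝ} {k : ℕ} {s : CP1 → S3}

lemma map_pairs_eq_prod (hX : ∀ i, Measurable (X i)) (hθ : ∀ i, Measurable (θ i))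
    (hunif : ∀ i, pdf.IsUniform (θ i) (Set.Icc 0 (2 * Real.pi)) P volume)
    (hind : iIndepFun θ P) (hXθ : IndepFun (fun ω i => X i ω) (fun ω i => θ i ω) P)
    {i j : Fin r} (hij : j ≠ i) :
    P.map (fun ω => ((X i ω, X j ω), (θ j ω, θ i ω)))
      = (P.map fun ω => (X i ω, X j ω)).prod (uniformPhase.prod uniformPhase) := by
  have h1 : IndepFun (fun ω => (X i ω, X j ω)) (fun ω => (θ j ω, θ i ω)) P :=
    hXθ.comp (φ := fun x : Fin r → CP1 => (x i, x j)) (ψ := fun t : Fin r → ℝ => (t j, t i))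
      (by fun_prop) (by fun_prop)
  rw [h1.map_prod_eq_prod_map_map ((hX i).prodMk (hX j)).aemeasurable
    ((hθ j).prodMk (hθ i)).aemeasurable, (hind.indepFun hij).map_prod_eq_prod_map_map
    (hθ j).aemeasurable (hθ i).aemeasurable, hunif i, hunif j]
  rfl

lemma integral_interaction_pair (hX : ∀ i, Measurable (X i)) (hθ : ∀ i, Measurable (θ i))
    (hunif : ∀ i, pdf.IsUniform (θ i) (Set.Icc 0 (2 * Real.pi)) P volume)
    (hind : iIndepFun θ P) (hXθ : IndepFun (fun ω i => X i ω) (fun ω i => θ i ω) P)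
    (hs : Measurable s) (hsec : ∀ x, hopf (s x) = x) (a b : Fin k) {i j : Fin r} (hij : j ≠ i) :
    Integrable (fun ω => interaction k s a b ((X i ω, X j ω), (θ j ω, θ i ω))) P ∧
    ∫ ω, interaction k s a b ((X i ω, X j ω), (θ j ω, θ i ω)) ∂P
      = ∫ z, fibrePotential (overlap z.1 z.2) ∂P.map fun ω => (X i ω, X j ω) := by
  have hm := measurable_interaction hs a b
  have hpair : Measurable fun ω => ((X i ω, X j ω), (θ j ω, θ i ω)) :=
    ((hX i).prodMk (hX j)).prodMk ((hθ j).prodMk (hθ i))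
  have : IsProbabilityMeasure (P.map fun ω => (X i ω, X j ω)) :=
    Measure.isProbabilityMeasure_map ((hX i).prodMk (hX j)).aemeasurable
  obtain ⟨h1, h2⟩ := integral_interaction hs hsec a b (P.map fun ω => (X i ω, X j ω))
  rw [← map_pairs_eq_prod hX hθ hunif hind hXθ hij] at h1 h2
  rw [integral_map hpair.aemeasurable hm.aestronglyMeasurable] at h2
  exact ⟨h1.comp_measurable hpair, h2⟩

/-- Pairs on a common fibre contribute a deterministic amount, so only interactions between distinct
fibres remain random. -/
lemma logEnergy_hopfLift (hk : 1 ≤ k) (x : Fin r → CP1) (t : Fin r → ℝ) :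
    logEnergy (hopfLift k s x t) = -(r * (k * Real.log k))
      + ∑ i, ∑ j ∈ Finset.univ.filter (fun j => j ≠ i), ∑ a : Fin k, ∑ b : Fin k,
        interaction k s a b ((x i, x j), (t j, t i)) := by
  have h (i : Fin r) : ∑ j, ∑ a : Fin k, ∑ b : Fin k,
      interaction k s a b ((x i, x j), (t j, t i)) = -(k * Real.log k)
      + ∑ j ∈ Finset.univ.filter (fun j => j ≠ i), ∑ a : Fin k, ∑ b : Fin k,
        interaction k s a b ((x i, x j), (t j, t i)) := by
    rw [← sum_log_dist_fibrePoint hk (t i) (s (x i)), Finset.filter_ne', add_comm]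
    exact (Finset.sum_erase_add _ _ (Finset.mem_univ i)).symm
  calc logEnergy (hopfLift k s x t)
      = ∑ i, ∑ a : Fin k, ∑ j, ∑ b : Fin k, interaction k s a b ((x i, x j), (t j, t i)) := by
        rw [logEnergy_eq_sum]
        simp only [Fintype.sum_prod_type]
        rfl
    _ = ∑ i, ∑ j, ∑ a : Fin k, ∑ b : Fin k, interaction k s a b ((x i, x j), (t j, t i)) :=
        Finset.sum_congr rfl fun i _ => Finset.sum_comm
    _ = _ := by
        simp_rw [h, Finset.sum_add_distrib]
        simp

lemma integral_logEnergy_hopfLift (hr : 1 ≤ r) (hk : 1 ≤ k) (hE : IsSphericalEnsemble P X)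
    (hθ : ∀ i, Measurable (θ i))
    (hunif : ∀ i, pdf.IsUniform (θ i) (Set.Icc 0 (2 * Real.pi)) P volume)
    (hind : iIndepFun θ P) (hXθ : IndepFun (fun ω i => X i ω) (fun ω i => θ i ω) P)
    (hs : Measurable s) (hsec : ∀ x, hopf (s x) = x) :
    Integrable (fun ω => logEnergy (hopfLift k s (fun i => X i ω) (fun i => θ i ω))) P ∧
    ∫ ω, logEnergy (hopfLift k s (fun i => X i ω) (fun i => θ i ω)) ∂P
      = -((k : ℝ) ^ 2 * (r : ℝ) ^ 2) / 4 - (r : ℝ) * k * Real.log k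
        + (k : ℝ) ^ 2 * (√Real.pi * Real.Gamma ((r : ℝ) + 1)
            / (4 * Real.Gamma ((r : ℝ) + 1 / 2)))
        - (k : ℝ) ^ 2 / 4 := by
  have key (a b : Fin k) {i j : Fin r} (hij : j ∈ Finset.univ.filter (fun j => j ≠ i)) :=
    integral_interaction_pair hE.measurable_points hθ hunif hind hXθ hs hsec a b
      (Finset.mem_filter.mp hij).2
  have hb (a : Fin k) {i j : Fin r} (hij : j ∈ Finset.univ.filter (fun j => j ≠ i)) :=
    integrable_finsetSum Finset.univ fun b _ => (key a b hij).1
  have ha {i j : Fin r} (hij : j ∈ Finset.univ.filter (fun j => j ≠ i)) :=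
    integrable_finsetSum Finset.univ fun a _ => hb a hij
  have hj (i : Fin r) := integrable_finsetSum (Finset.univ.filter (fun j => j ≠ i))
    fun j hij => ha hij
  have hi := integrable_finsetSum Finset.univ fun i _ => hj i
  simp_rw [logEnergy_hopfLift hk]
  refine ⟨(integrable_const _).add hi, ?_⟩
  have hpair : ∑ i, ∑ j ∈ Finset.univ.filter (fun j => j ≠ i),
      ∫ z, fibrePotential (overlap z.1 z.2) ∂P.map (fun ω => (X i ω, X j ω))
      = ∫ z, fibrePotential (overlap z.1 z.2) ∂pairMeasure P X := by
    rw [pairMeasure, integral_finsetSum_measure fun i _ => integrable_fibrePotential_overlap _]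
    exact Finset.sum_congr rfl fun i _ => (integral_finsetSum_measure fun j _ =>
      integrable_fibrePotential_overlap _).symm
  have hsum : ∫ ω, ∑ i, ∑ j ∈ Finset.univ.filter (fun j => j ≠ i), ∑ a : Fin k, ∑ b : Fin k,
      interaction k s a b ((X i ω, X j ω), (θ j ω, θ i ω)) ∂P
      = (k : ℝ) ^ 2 * ∫ z, fibrePotential (overlap z.1 z.2) ∂pairMeasure P X := by
    rw [integral_finsetSum _ fun i _ => hj i, ← hpair, Finset.mul_sum]
    refine Finset.sum_congr rfl fun i _ => ?_
    rw [integral_finsetSum _ fun j hij => ha hij, Finset.mul_sum]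
    refine Finset.sum_congr rfl fun j hij => ?_
    rw [integral_finsetSum _ fun a _ => hb a hij]
    simp_rw [fun a => integral_finsetSum Finset.univ fun b _ => (key a b hij).1,
      fun a b => (key a b hij).2]
    simp
    ring
  rw [integral_add (integrable_const _) hi, hsum, integral_pairMeasure_fibrePotential hE hr,
    sq_mul_integral_fibrePotential hr]
  simp
  ring

end Expectation

end HopfSpherical

end

/-! ### Comparison with the asymptotic expansion -/

theorem proposition3p6 :
    ∃ C : ℝ, ∀ (r k N : ℕ), 1 ≤ r → 1 ≤ k → N = k * r →
      ∀ (Ω : Type*) [MeasurableSpace Ω] (P : Measure Ω) [IsProbabilityMeasure P]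
        (X : Fin r → Ω → HopfSpherical.CP1) (θ : Fin r → Ω → ℝ)
        (s : HopfSpherical.CP1 → HopfSpherical.S3),
        HopfSpherical.IsSphericalEnsemble P X →
        (∀ i, Measurable (θ i)) →
        (∀ i, pdf.IsUniform (θ i) (Set.Icc 0 (2 * Real.pi)) P volume) →
        iIndepFun θ P →
        IndepFun (fun ω i => X i ω) (fun ω i => θ i ω) P →
        Measurable s →
        (∀ x, HopfSpherical.hopf (s x) = x) →
        Integrable (fun ω => HopfSpherical.logEnergy
            (HopfSpherical.hopfLift k s (fun i => X i ω) (fun i => θ i ω))) P ∧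
        (∫ ω, HopfSpherical.logEnergy
            (HopfSpherical.hopfLift k s (fun i => X i ω) (fun i => θ i ω)) ∂P
          = -((k : ℝ) ^ 2 * (r : ℝ) ^ 2) / 4 - (r : ℝ) * k * Real.log k
            + (k : ℝ) ^ 2 * (Real.sqrt Real.pi * Real.Gamma ((r : ℝ) + 1)
                / (4 * Real.Gamma ((r : ℝ) + 1 / 2)))
            - (k : ℝ) ^ 2 / 4) ∧
        |(∫ ω, HopfSpherical.logEnergy
            (HopfSpherical.hopfLift k s (fun i => X i ω) (fun i => θ i ω)) ∂P)
          - (-(N : ℝ) ^ 2 / 4 - (N : ℝ) * Real.log k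
            + Real.sqrt Real.pi / 4 * Real.sqrt N * (k : ℝ) ^ (3 / 2 : ℝ)
            - (k : ℝ) ^ 2 / 4)|
          ≤ C * ((k : ℝ) ^ 2 * Real.sqrt ((k : ℝ) / N)) := by
  -- This is the coefficient of the Gamma quotient; `abs_Gamma_quotient_sub_sqrt_le` has constant
  -- `1`, and `√(k/N) = 1/√r`.
  refine ⟨√Real.pi / 4, ?_⟩
  rintro r k N hr hk rfl Ω _ P _ X θ s hE hθ hunif hind hXθ hs hsec
  obtain ⟨h1, h2⟩ := HopfSpherical.integral_logEnergy_hopfLift hr hk hE hθ hunif hind hXθ hs hsec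
  refine ⟨h1, h2, ?_⟩
  have hr0 : (0 : ℝ) < r := by exact_mod_cast hr
  have hk0 : (0 : ℝ) < k := by exact_mod_cast hk
  have hG : Real.Gamma ((r : ℝ) + 1 / 2) ≠ 0 := (Real.Gamma_pos_of_pos (by positivity)).ne'
  have hk2 : √(k : ℝ) * (k : ℝ) ^ (3 / 2 : ℝ) = (k : ℝ) ^ 2 := by
    rw [Real.sqrt_eq_rpow, ← Real.rpow_add hk0]
    norm_num
  have hquot : √((k : ℝ) / (k * r : ℕ)) = 1 / √(r : ℝ) := by
    push_cast
    rw [div_mul_cancel_left₀ hk0.ne', Real.sqrt_inv, one_div]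
  have hdiff : -((k : ℝ) ^ 2 * (r : ℝ) ^ 2) / 4 - (r : ℝ) * k * Real.log k
      + (k : ℝ) ^ 2 * (√Real.pi * Real.Gamma ((r : ℝ) + 1) / (4 * Real.Gamma ((r : ℝ) + 1 / 2)))
      - (k : ℝ) ^ 2 / 4
      - (-((k * r : ℕ) : ℝ) ^ 2 / 4 - ((k * r : ℕ) : ℝ) * Real.log k
        + √Real.pi / 4 * √((k * r : ℕ) : ℝ) * (k : ℝ) ^ (3 / 2 : ℝ) - (k : ℝ) ^ 2 / 4)
      = √Real.pi / 4 * (k : ℝ) ^ 2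
        * (Real.Gamma ((r : ℝ) + 1) / Real.Gamma ((r : ℝ) + 1 / 2) - √(r : ℝ)) := by
    push_cast
    rw [Real.sqrt_mul hk0.le]
    linear_combination (exp := 1) (-(√Real.pi / 4 * √(r : ℝ))) * hk2
  rw [h2, hdiff, hquot, abs_mul, abs_of_nonneg (by positivity), ← mul_assoc]
  gcongr
  exact HopfSpherical.abs_Gamma_quotient_sub_sqrt_le hr0
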